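/- Let $N\ge 1$ be an integer, and let $s>0$ be non-integer and $1\le p<\infty$ be such that $sp<N$. Set $q:=Np/(N-sp)$. For $g:\mathbb R^N\to\mathbb R$ and $h\in\mathbb R^N$, let $\Delta_h g(x):=g(x+h)-g(x)$, and let $\Delta_h^{m}$ be the $m$-th iterate of $\Delta_h$. Let $\dot W^{s,p}$ be the space of functions $g\in L^1_{\rm loc}(\mathbb R^N)$ such that $$|g|_{W^{s,p}}^p:=\int_{\mathbb R^N}\frac{\|\Delta_h^{\lfloor s\rfloor+1}g\|_{L^p(\mathbb R^N)}^p}{|h|^{sp+N}}\,dh<\infty .$$ Let $(f_n)$ be a sequence in $L^q(\mathbb R^N)\cap\dot W^{s,p}$ and let $f\in L^q(\mathbb R^N)\cap\dot W^{s,p}$. Suppose that $f_n\rightharpoonup f$ in $L^q\cap\dot W^{s,p}$, in the sense that $\sup_n|f_n|_{W^{s,p}}<\infty$ and $f_n\to f$ in $L^p_{\rm loc}(\mathbb R^N)$. Then $$\sup_{\xi\in\mathbb S^{N-1}}\int_0^\infty\!\!\int_{\mathbb R^N}t^{-sp-1}\,\Big|\,|\Delta_{t\xi}^{\lfloor s\rfloor+1}f_n(x)|^p-|\Delta_{t\xi}^{\lfloor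 s\rfloor+1}(f_n-f)(x)|^p-|\Delta_{t\xi}^{\lfloor s\rfloor+1}f(x)|^p\,\Big|\,dx\,dt\longrightarrow 0\quad\text{as } n\to\infty .$$ -/

import Mathlib

open MeasureTheory Filter Topology
open scoped ENNReal

/-- The iterated difference `Δ_h^{⌊s⌋+1} g`, where `Δ_h g (x) = g (x + h) - g x`. -/
noncomputable def fracDiff {N : ℕ} (s : ℝ) (h : EuclideanSpace ℝ (Fin N))
    (g : EuclideanSpace ℝ (Fin N) → ℝ) : EuclideanSpace ℝ (Fin N) → ℝ :=
  (fwdDiff h)^[⌊s⌋₊ + 1] g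

/-- The (extended) seminorm `|g|_{W^{s,p}}`, for non-integer `s > 0`:
`|g|_{W^{s,p}}^p = ∫ ‖Δ_h^{⌊s⌋+1} g‖_{L^p}^p / |h|^{sp+N} dh`. -/
noncomputable def fracSeminorm {N : ℕ} (s p : ℝ) (g : EuclideanSpace ℝ (Fin N) → ℝ) : ℝ≥0∞ :=
  (∫⁻ h : EuclideanSpace ℝ (Fin N),
    eLpNorm (fracDiff s h g) (ENNReal.ofReal p) volume ^ p /
      ENNReal.ofReal (‖h‖ ^ (s * p + N))) ^ (1 / p)

/-- The homogeneous fractional Sobolev space: locally integrable functions with finite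
seminorm. -/
def MemHomSobolev {N : ℕ} (s p : ℝ) (g : EuclideanSpace ℝ (Fin N) → ℝ) : Prop :=
  LocallyIntegrable g volume ∧ fracSeminorm s p g < ∞

/-- The intersection of `L^q`, `q = Np / (N - sp)`, with the homogeneous fractional Sobolev
space. -/
def MemRingSobolev {N : ℕ} (s p : ℝ) (g : EuclideanSpace ℝ (Fin N) → ℝ) : Prop :=
  MemLp g (ENNReal.ofReal (N * p / (N - s * p))) volume ∧ MemHomSobolev s p g

/-- Weak convergence in `L^q ∩ Ẇ^{s,p}`: all functions lie in the space, the seminorms of the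
sequence are bounded, and the sequence converges in `L^p` on every compact set. -/
structure WeakConvRingSobolev {N : ℕ} (s p : ℝ) (f : ℕ → EuclideanSpace ℝ (Fin N) → ℝ)
    (g : EuclideanSpace ℝ (Fin N) → ℝ) : Prop where
  mem_seq : ∀ n, MemRingSobolev s p (f n)
  mem_lim : MemRingSobolev s p g
  bounded : ⨆ n, fracSeminorm s p (f n) < ∞
  tendsto_loc : ∀ K : Set (EuclideanSpace ℝ (Fin N)), IsCompact K →
    Tendsto (fun n => eLpNorm (f n - g) (ENNReal.ofReal p) (volume.restrict K)) atTop (𝓝 0)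

/-!
The proof follows the Brezis–Lieb lemma. With `a = Δ (f n - g)` and `b = Δ g`, the elementary
inequality `||a + b| ^ p - |a| ^ p - |b| ^ p| ≤ ε |a| ^ p + C_ε |b| ^ p`
(`exists_ofReal_abs_abs_add_rpow_sub_le`) is used as it stands off a compact set of pairs `(t, x)`
in `(0, ∞) × ℝ^N`, and with `a` and `b` exchanged on it. The `ε` terms are harmless as soon as the
energies `∫∫ t ^ (-sp - 1) |Δ_{tξ} u| ^ p` are bounded uniformly in `ξ`, for `u = g` and
`u = f n - g`. On the compact set the `C_ε` term tends to zero because `f n → g` in `L^p_loc`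
(`exists_setLIntegral_rayCore_le`). Off the compact set one needs the tails of the energy of `g` to
be small uniformly in `ξ`.

Both uniform statements come from one localized estimate, `exists_lintegral_direction_le`: the energy
in a fixed direction is bounded by the full seminorm, even when both are restricted to suitable
sets. It rests on the identity (`fwdDiff_iter_eq_sum_fwdDiff_iter`)
`Δ_h^M u (x) = ∑_{k=1}^M (-1)^k (M choose k) (Δ_{kv}^M u (x + k h) - Δ_{h+kv}^M u (x))`,
valid for every `v`. With `h = t ξ` one averages over `v = t w`, `w` in a fixed annulus so small that
all the steps `k v` and `h + k v` have length comparable to `t`, and integrates in `t`. The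
tails of the full seminorm of `g` do not involve `ξ` and tend to zero by dominated convergence
(`tendsto_setLIntegral_shiftTail`).
-/

/-! ### Elementary inequalities -/

lemma exists_enorm_sum_mul_rpow_le {ι : Type*} (s : Finset ι) (c : ι → ℝ) {p : ℝ} (hp : 1 ≤ p) :
    ∃ C : ℝ≥0∞, C ≠ ∞ ∧ ∀ a : ι → ℝ,
      ‖∑ i ∈ s, c i * a i‖ₑ ^ p ≤ C * ∑ i ∈ s, ‖a i‖ₑ ^ p := by
  have hp0 : 0 ≤ p := by linarith
  refine ⟨(s.card : ℝ≥0∞) ^ (p - 1) * ∑ i ∈ s, ‖c i‖ₑ ^ p, ?_, fun a => ?_⟩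
  · refine ENNReal.mul_ne_top ?_ ?_
    · exact ENNReal.rpow_ne_top_of_nonneg (by linarith) (ENNReal.natCast_ne_top _)
    · exact ENNReal.sum_ne_top.2 fun i _ => ENNReal.rpow_ne_top_of_nonneg hp0 enorm_ne_top
  · calc ‖∑ i ∈ s, c i * a i‖ₑ ^ p ≤ (∑ i ∈ s, ‖c i‖ₑ * ‖a i‖ₑ) ^ p := by
          refine ENNReal.rpow_le_rpow ((enorm_sum_le _ _).trans_eq ?_) hp0
          simp
      _ ≤ (s.card : ℝ≥0∞) ^ (p - 1) * ∑ i ∈ s, (‖c i‖ₑ * ‖a i‖ₑ) ^ p :=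
          ENNReal.rpow_sum_le_const_mul_sum_rpow _ _ hp
      _ ≤ (s.card : ℝ≥0∞) ^ (p - 1) * ((∑ i ∈ s, ‖c i‖ₑ ^ p) * ∑ i ∈ s, ‖a i‖ₑ ^ p) := by
          gcongr
          rw [Finset.mul_sum]
          refine Finset.sum_le_sum fun i hi => ?_
          rw [ENNReal.mul_rpow_of_nonneg _ _ hp0]
          gcongr
          exact Finset.single_le_sum (f := fun i => ‖c i‖ₑ ^ p) (fun _ _ => zero_le) hi
      _ = _ := by rw [mul_assoc]

lemma enorm_sub_rpow_le {p : ℝ} (hp : 1 ≤ p) (a b : ℝ) :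
    ‖a - b‖ₑ ^ p ≤ 2 ^ (p - 1) * (‖a‖ₑ ^ p + ‖b‖ₑ ^ p) :=
  (ENNReal.rpow_le_rpow enorm_sub_le (by linarith)).trans
    (ENNReal.rpow_add_le_mul_rpow_add_rpow _ _ hp)

/-- Convexity of `x ↦ x ^ p`, applied to `l * (|a| / l) + (1 - l) * (|b| / (1 - l))` with `l`
close to `1`. -/
lemma exists_abs_add_rpow_le {p : ℝ} (hp : 1 ≤ p) {ε : ℝ} (hε : 0 < ε) :
    ∃ C : ℝ, 0 ≤ C ∧ ∀ a b : ℝ, |a + b| ^ p ≤ (1 + ε) * |a| ^ p + C * |b| ^ p := by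
  have hp0 : 0 < p := by linarith
  -- `l` is chosen so that `l ^ (1 - p) = (1 + ε) ^ ((p - 1) / p) ≤ 1 + ε`
  set l : ℝ := (1 + ε) ^ (-(1 / p)) with hl
  have hl0 : 0 < l := by positivity
  have hl1 : l < 1 := Real.rpow_lt_one_of_one_lt_of_neg (by linarith) (by simp; linarith)
  have hl2 : l ^ (1 - p) ≤ 1 + ε := by
    rw [hl, ← Real.rpow_mul (by linarith)]
    conv_rhs => rw [← Real.rpow_one (1 + ε)]
    refine Real.rpow_le_rpow_of_exponent_le (by linarith) ?_
    have : 0 < 1 / p := by positivity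
    have h2 : 1 / p * p = 1 := by field_simp
    nlinarith
  have hl3 : 0 < 1 - l := by linarith
  refine ⟨(1 - l) ^ (1 - p), by positivity, fun a b => ?_⟩
  have scale : ∀ r : ℝ, 0 < r → ∀ x : ℝ, 0 ≤ x → r * (x / r) ^ p = r ^ (1 - p) * x ^ p := by
    intro r hr x hx
    rw [Real.div_rpow hx hr.le, Real.rpow_sub hr, Real.rpow_one]
    field_simp
  calc |a + b| ^ p ≤ (l * (|a| / l) + (1 - l) * (|b| / (1 - l))) ^ p := by
        refine Real.rpow_le_rpow (abs_nonneg _) ((abs_add_le a b).trans_eq ?_) hp0.le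
        field_simp
    _ ≤ l * (|a| / l) ^ p + (1 - l) * (|b| / (1 - l)) ^ p :=
        (convexOn_rpow hp).2 (Set.mem_Ici.2 (by positivity)) (Set.mem_Ici.2 (by positivity))
          hl0.le hl3.le (by ring)
    _ = l ^ (1 - p) * |a| ^ p + (1 - l) ^ (1 - p) * |b| ^ p := by
        rw [scale l hl0 _ (abs_nonneg a), scale _ hl3 _ (abs_nonneg b)]
    _ ≤ _ := by gcongr

/-- The elementary inequality behind the Brezis–Lieb lemma. -/
lemma exists_abs_abs_add_rpow_sub_le {p : ℝ} (hp : 1 ≤ p) {ε : ℝ} (hε : 0 < ε) :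
    ∃ C : ℝ, 0 ≤ C ∧ ∀ a b : ℝ,
      |(|a + b| ^ p - |a| ^ p - |b| ^ p)| ≤ ε * |a| ^ p + C * |b| ^ p := by
  obtain ⟨C₁, hC₁, h₁⟩ := exists_abs_add_rpow_le hp hε
  obtain ⟨C₂, hC₂, h₂⟩ := exists_abs_add_rpow_le hp (half_pos hε)
  obtain ⟨C₃, hC₃, h₃⟩ := exists_abs_add_rpow_le hp one_pos
  refine ⟨C₁ + C₂ + ε / 2 * C₃ + 1, by positivity, fun a b => ?_⟩
  have ha : 0 ≤ |a| ^ p := by positivity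
  have hb : 0 ≤ |b| ^ p := by positivity
  have e₁ := h₁ a b
  have e₂ := h₂ (a + b) (-b)
  have e₃ := mul_le_mul_of_nonneg_left (h₃ a b) (half_pos hε).le
  rw [add_neg_cancel_right, abs_neg] at e₂
  have k₁ := mul_nonneg hC₁ hb
  have k₂ := mul_nonneg hC₂ hb
  have k₃ := mul_nonneg (mul_nonneg (half_pos hε).le hC₃) hb
  have k₄ := mul_nonneg hε.le ha
  rw [abs_le]
  constructor <;> nlinarith

lemma ofReal_abs_rpow {p : ℝ} (hp : 0 ≤ p) (a : ℝ) :
    ENNReal.ofReal (|a| ^ p) = ‖a‖ₑ ^ p := by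
  rw [← ENNReal.ofReal_rpow_of_nonneg (abs_nonneg a) hp, Real.enorm_eq_ofReal_abs]

lemma exists_ofReal_abs_abs_add_rpow_sub_le {p : ℝ} (hp : 1 ≤ p) {ε : ℝ} (hε : 0 < ε) :
    ∃ C : ℝ≥0∞, C ≠ ∞ ∧ ∀ a b : ℝ,
      ENNReal.ofReal |(|a + b| ^ p - |a| ^ p - |b| ^ p)|
        ≤ ENNReal.ofReal ε * ‖a‖ₑ ^ p + C * ‖b‖ₑ ^ p := by
  obtain ⟨C, hC, h⟩ := exists_abs_abs_add_rpow_sub_le hp hε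
  refine ⟨ENNReal.ofReal C, ENNReal.ofReal_ne_top, fun a b => ?_⟩
  refine (ENNReal.ofReal_le_ofReal (h a b)).trans_eq ?_
  rw [ENNReal.ofReal_add (by positivity) (by positivity), ENNReal.ofReal_mul hε.le,
    ENNReal.ofReal_mul hC, ofReal_abs_rpow (by linarith), ofReal_abs_rpow (by linarith)]

/-! ### Iterated differences -/

section Algebra
variable {E : Type*} [AddCommGroup E]

lemma fwdDiff_iter_eq_sum_mul (M : ℕ) (h : E) (u : E → ℝ) (x : E) :
    (fwdDiff h)^[M] u x
      = ∑ k ∈ Finset.range (M + 1), ((-1) ^ (M - k) * (M.choose k : ℝ)) * u (x + k • h) := by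
  rw [fwdDiff_iter_eq_sum_shift]
  exact Finset.sum_congr rfl fun k _ => by simp [zsmul_eq_mul]

/-- The difference with step `h` in terms of differences with the steps `k • v` and `h + k • v`,
`1 ≤ k ≤ M`, for an arbitrary `v`. Expanding both sides of `key` below into translates
`u (x + k • h + (j * k) • v)` gives the same double sum, with `j` and `k` exchanged. -/
lemma fwdDiff_iter_eq_sum_fwdDiff_iter {M : ℕ} (hM : 1 ≤ M) (h v : E) (u : E → ℝ) (x : E) :
    (fwdDiff h)^[M] u x = ∑ k ∈ Finset.range M, ((-1) ^ (k + 1) * (M.choose (k + 1) : ℝ)) *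
      ((fwdDiff ((k + 1) • v))^[M] u (x + (k + 1) • h)
        - (fwdDiff (h + (k + 1) • v))^[M] u x) := by
  have key : ∑ k ∈ Finset.range (M + 1), ((-1) ^ k * (M.choose k : ℝ)) *
        (fwdDiff (k • v))^[M] u (x + k • h)
      = ∑ k ∈ Finset.range (M + 1), ((-1) ^ k * (M.choose k : ℝ)) *
        (fwdDiff (h + k • v))^[M] u x := by
    simp only [fwdDiff_iter_eq_sum_mul, Finset.mul_sum]
    rw [Finset.sum_comm]
    refine Finset.sum_congr rfl fun j hj => Finset.sum_congr rfl fun k hk => ?_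
    have hj' : j ≤ M := Nat.lt_succ_iff.1 (Finset.mem_range.1 hj)
    have hk' : k ≤ M := Nat.lt_succ_iff.1 (Finset.mem_range.1 hk)
    have sign : (-1 : ℝ) ^ k * (-1) ^ (M - j) = (-1) ^ j * (-1) ^ (M - k) := by
      rw [← pow_add, ← pow_add]
      have e : (k + (M - j)) + 2 * j = (j + (M - k)) + 2 * k := by omega
      have := congrArg (fun n => (-1 : ℝ) ^ n) e
      simpa [pow_add, pow_mul] using this
    have arg : x + k • h + j • k • v = x + k • (h + j • v) := by
      rw [smul_add, smul_comm j k v, add_assoc]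
    rw [arg]
    linear_combination (M.choose k : ℝ) * (M.choose j : ℝ) * u (x + k • (h + j • v)) * sign
  rw [Finset.sum_range_succ', Finset.sum_range_succ'] at key
  have zero : (fwdDiff (0 : E))^[M] u x = 0 := by
    obtain ⟨m, rfl⟩ : ∃ m, M = m + 1 := ⟨M - 1, by omega⟩
    rw [Function.iterate_succ_apply']
    simp [fwdDiff]
  simp only [zero_smul, add_zero, pow_zero, Nat.choose_zero_right, Nat.cast_one, one_mul,
    zero] at key
  simp only [mul_sub, Finset.sum_sub_distrib]
  linarith

lemma exists_enorm_fwdDiff_iter_rpow_le {M : ℕ} (hM : 1 ≤ M) {p : ℝ} (hp : 1 ≤ p) :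
    ∃ C : ℝ≥0∞, C ≠ ∞ ∧ ∀ (h v : E) (u : E → ℝ) (x : E),
      ‖(fwdDiff h)^[M] u x‖ₑ ^ p ≤ C * ∑ k ∈ Finset.range M,
        (‖(fwdDiff ((k + 1) • v))^[M] u (x + (k + 1) • h)‖ₑ ^ p
          + ‖(fwdDiff (h + (k + 1) • v))^[M] u x‖ₑ ^ p) := by
  obtain ⟨C, hC, hCle⟩ := exists_enorm_sum_mul_rpow_le (Finset.range M)
    (fun k => (-1) ^ (k + 1) * (M.choose (k + 1) : ℝ)) hp
  refine ⟨C * 2 ^ (p - 1), ENNReal.mul_ne_top hC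
    (ENNReal.rpow_ne_top_of_nonneg (by linarith) (by simp)), fun h v u x => ?_⟩
  rw [fwdDiff_iter_eq_sum_fwdDiff_iter hM h v u x, mul_assoc, Finset.mul_sum]
  refine (hCle _).trans ?_
  gcongr
  exact enorm_sub_rpow_le hp _ _

lemma exists_enorm_fwdDiff_iter_rpow_le_sum (M : ℕ) {p : ℝ} (hp : 1 ≤ p) :
    ∃ C : ℝ≥0∞, C ≠ ∞ ∧ ∀ (h : E) (u : E → ℝ) (x : E),
      ‖(fwdDiff h)^[M] u x‖ₑ ^ p ≤ C * ∑ k ∈ Finset.range (M + 1), ‖u (x + k • h)‖ₑ ^ p := by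
  obtain ⟨C, hC, hCle⟩ := exists_enorm_sum_mul_rpow_le (Finset.range (M + 1))
    (fun k => (-1) ^ (M - k) * (M.choose k : ℝ)) hp
  exact ⟨C, hC, fun h u x => by rw [fwdDiff_iter_eq_sum_mul]; exact hCle _⟩

lemma fwdDiff_iter_sub (M : ℕ) (h : E) (u v : E → ℝ) (x : E) :
    (fwdDiff h)^[M] (u - v) x = (fwdDiff h)^[M] u x - (fwdDiff h)^[M] v x := by
  simp only [fwdDiff_iter_eq_sum_mul, Pi.sub_apply, mul_sub, Finset.sum_sub_distrib]

end Algebra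

section Measurability
variable {E : Type*} [NormedAddCommGroup E] [NormedSpace ℝ E] [FiniteDimensional ℝ E]
  [MeasurableSpace E] [BorelSpace E]

lemma measurable_fwdDiff_iter {X : Type*} [MeasurableSpace X] (M : ℕ) {u : E → ℝ}
    (hu : Measurable u) {a b : X → E} (ha : Measurable a) (hb : Measurable b) :
    Measurable fun z => (fwdDiff (a z))^[M] u (b z) := by
  have := FiniteDimensional.proper_real E
  simp only [fwdDiff_iter_eq_sum_mul]
  fun_prop

end Measurability

lemma fwdDiff_iter_congr_ae {E : Type*} [AddCommGroup E] [MeasurableSpace E]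
    [MeasurableAdd E] {μ : Measure E} [μ.IsAddRightInvariant] (M : ℕ) (h : E) {u v : E → ℝ}
    (huv : u =ᵐ[μ] v) :
    (fwdDiff h)^[M] u =ᵐ[μ] (fwdDiff h)^[M] v := by
  have hk : ∀ k : ℕ, ∀ᵐ x ∂μ, u (x + k • h) = v (x + k • h) := fun k =>
    (measurePreserving_add_right μ (k • h)).quasiMeasurePreserving.ae huv
  filter_upwards [ae_all_iff.2 hk] with x hx
  simp only [fwdDiff_iter_eq_sum_mul, hx]

/-! ### Averaging over dilated annuli -/

section Annulus
variable {E : Type*} [NormedAddCommGroup E] [NormedSpace ℝ E] [FiniteDimensional ℝ E]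
  [MeasurableSpace E] [BorelSpace E] (μ : Measure E) [μ.IsAddHaarMeasure]

/-- The closed annulus `a ≤ ‖z‖ ≤ b` centred at the origin. -/
def closedAnnulus (E : Type*) [NormedAddCommGroup E] (a b : ℝ) : Set E :=
  {z | a ≤ ‖z‖ ∧ ‖z‖ ≤ b}

omit [NormedSpace ℝ E] [FiniteDimensional ℝ E] in
lemma measurableSet_closedAnnulus (a b : ℝ) : MeasurableSet (closedAnnulus E a b) :=
  (measurableSet_le measurable_const measurable_norm).inter
    (measurableSet_le measurable_norm measurable_const)

lemma lintegral_comp_smul_of_pos {r : ℝ} (hr : 0 < r) {Ψ : E → ℝ≥0∞} (hΨ : Measurable Ψ) :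
    ∫⁻ z, Ψ (r • z) ∂μ
      = ENNReal.ofReal (r ^ (-(Module.finrank ℝ E : ℝ))) * ∫⁻ z, Ψ z ∂μ := by
  rw [← lintegral_map hΨ (measurable_const_smul r), Measure.map_addHaar_smul μ hr.ne',
    lintegral_smul_measure, smul_eq_mul, abs_of_pos (by positivity), Real.rpow_neg hr.le,
    Real.rpow_natCast]

lemma setLIntegral_comp_affine_le {A S : Set E} (hA : MeasurableSet A) (hS : MeasurableSet S)
    {Ψ : E → ℝ≥0∞} (hΨ : Measurable Ψ) (c : E) {k : ℝ} (hk : 1 ≤ k) (hAS : ∀ w ∈ A, c + k • w ∈ S) :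
    ∫⁻ w in A, Ψ (c + k • w) ∂μ ≤ ∫⁻ z in S, Ψ z ∂μ := by
  have hk0 : 0 < k := by linarith
  have hm : Measurable (S.indicator Ψ) := hΨ.indicator hS
  calc ∫⁻ w in A, Ψ (c + k • w) ∂μ
      ≤ ∫⁻ w in A, S.indicator Ψ (c + k • w) ∂μ := by
        refine setLIntegral_mono' hA fun w hw => ?_
        rw [Set.indicator_of_mem (hAS w hw)]
    _ ≤ ∫⁻ w, S.indicator Ψ (c + k • w) ∂μ := setLIntegral_le_lintegral _ _
    _ = ENNReal.ofReal (k ^ (-(Module.finrank ℝ E : ℝ))) * ∫⁻ z, S.indicator Ψ (c + z) ∂μ :=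
        lintegral_comp_smul_of_pos μ hk0 (hm.comp (measurable_const_add c))
    _ ≤ 1 * ∫⁻ z, S.indicator Ψ (c + z) ∂μ := by
        gcongr
        rw [ENNReal.ofReal_le_one]
        exact Real.rpow_le_one_of_one_le_of_nonpos hk (by simp)
    _ = ∫⁻ z in S, Ψ z ∂μ := by
        rw [one_mul, lintegral_add_left_eq_self, lintegral_indicator hS]

/-- Averaging `Φ` over the dilated annuli `t • closedAnnulus E a b` and integrating in `t` gives back
a weighted integral of `Φ`: by Tonelli, each `h` is met only for `t` comparable to `‖h‖`. -/
lemma exists_lintegral_dilate_annulus_le {a b θ : ℝ} (ha : 0 < a) (hb : 0 < b) (hθ : 0 ≤ θ) :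
    ∃ C : ℝ≥0∞, C ≠ ∞ ∧ ∀ Φ : E → ℝ≥0∞, Measurable Φ →
      ∫⁻ t in Set.Ioi (0 : ℝ), ENNReal.ofReal (t ^ (-θ - 1)) *
          ∫⁻ z in closedAnnulus E a b, Φ (t • z) ∂μ
        ≤ C * ∫⁻ h, Φ h / ENNReal.ofReal (‖h‖ ^ (θ + Module.finrank ℝ E)) ∂μ := by
  set d : ℝ := (Module.finrank ℝ E : ℝ) with hd
  have hd0 : 0 ≤ d := by positivity
  refine ⟨ENNReal.ofReal (b ^ (θ + d + 1) / a), ENNReal.ofReal_ne_top, fun Φ hΦ => ?_⟩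
  have := FiniteDimensional.proper_real E
  let T : Set (ℝ × E) := {q | q.1⁻¹ • q.2 ∈ closedAnnulus E a b}
  have hT : MeasurableSet T :=
    (measurableSet_closedAnnulus a b).preimage (by fun_prop)
  let κ : ℝ × E → ℝ≥0∞ := fun q =>
    ENNReal.ofReal (q.1 ^ (-θ - 1)) * ENNReal.ofReal (q.1 ^ (-d)) * T.indicator (fun q => Φ q.2) q
  have hκ : Measurable κ := by
    have : Measurable (T.indicator fun q : ℝ × E => Φ q.2) :=
      (hΦ.comp measurable_snd).indicator hT
    fun_prop
  calc ∫⁻ t in Set.Ioi (0 : ℝ), ENNReal.ofReal (t ^ (-θ - 1)) *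
          ∫⁻ z in closedAnnulus E a b, Φ (t • z) ∂μ
      = ∫⁻ t in Set.Ioi (0 : ℝ), ∫⁻ h, κ (t, h) ∂μ := by
        refine setLIntegral_congr_fun measurableSet_Ioi fun t ht => ?_
        have ht0 : 0 < t := ht
        simp only [κ]
        have hm : Measurable fun h => T.indicator (fun q : ℝ × E => Φ q.2) (t, h) :=
          ((hΦ.comp measurable_snd).indicator hT).comp (by fun_prop)
        rw [lintegral_const_mul _ hm, mul_assoc, ← lintegral_comp_smul_of_pos μ ht0 hm,
          ← lintegral_indicator (measurableSet_closedAnnulus a b)]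
        congr 1
        refine lintegral_congr fun z => ?_
        by_cases hz : z ∈ closedAnnulus E a b
        · have : (t, t • z) ∈ T := by simpa [T, smul_smul, ht0.ne'] using hz
          simp [hz, this]
        · have : (t, t • z) ∉ T := by simpa [T, smul_smul, ht0.ne'] using hz
          simp [hz, this]
    _ = ∫⁻ h, (∫⁻ t in Set.Ioi (0 : ℝ), κ (t, h)) ∂μ :=
        lintegral_lintegral_swap (f := fun t h => κ (t, h)) hκ.aemeasurable
    _ ≤ ∫⁻ h, ENNReal.ofReal (b ^ (θ + d + 1) / a) *
          (Φ h / ENNReal.ofReal (‖h‖ ^ (θ + d))) ∂μ := by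
        refine lintegral_mono fun h => ?_
        rcases eq_or_ne h 0 with rfl | hh
        · have h0 : ∀ t : ℝ, κ (t, 0) = 0 := fun t => by
            have : (t, (0 : E)) ∉ T := by simp [T, closedAnnulus, ha]
            simp [κ, this]
          simp [h0]
        have hr : 0 < ‖h‖ := norm_pos_iff.2 hh
        have bound : ∀ t ∈ Set.Ioi (0 : ℝ), κ (t, h) ≤
            (Set.Icc 0 (‖h‖ / a)).indicator
              (fun _ => ENNReal.ofReal ((‖h‖ / b) ^ (-(θ + d + 1))) * Φ h) t := by
          intro t ht
          have ht0 : 0 < t := ht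
          by_cases hmem : (t, h) ∈ T
          · have h1 : a ≤ t⁻¹ * ‖h‖ ∧ t⁻¹ * ‖h‖ ≤ b := by
              simpa [T, closedAnnulus, norm_smul, abs_of_pos ht0] using hmem
            have h2 : t ≤ ‖h‖ / a := by
              rw [le_div_iff₀ ha]
              have := mul_le_mul_of_nonneg_left h1.1 ht0.le
              rwa [mul_inv_cancel_left₀ ht0.ne'] at this
            have h3 : ‖h‖ / b ≤ t := by
              rw [div_le_iff₀ hb]
              have := mul_le_mul_of_nonneg_left h1.2 ht0.le
              rwa [mul_inv_cancel_left₀ ht0.ne'] at this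
            rw [Set.indicator_of_mem (show t ∈ Set.Icc 0 (‖h‖ / a) from ⟨ht0.le, h2⟩)]
            simp only [κ, Set.indicator_of_mem hmem]
            rw [← ENNReal.ofReal_mul (by positivity), ← Real.rpow_add ht0]
            gcongr ENNReal.ofReal ?_ * _
            rw [show -θ - 1 + -d = -(θ + d + 1) by ring]
            exact Real.rpow_le_rpow_of_nonpos (by positivity) h3 (by linarith)
          · simp [κ, hmem]
        refine (setLIntegral_mono' measurableSet_Ioi bound).trans
          ((setLIntegral_le_lintegral _ _).trans ?_)
        rw [lintegral_indicator_const measurableSet_Icc, Real.volume_Icc, sub_zero,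
          ENNReal.div_eq_inv_mul, mul_right_comm, ← mul_assoc,
          ← ENNReal.ofReal_mul (by positivity),
          ← ENNReal.ofReal_inv_of_pos (by positivity), ← ENNReal.ofReal_mul (by positivity)]
        refine le_of_eq ?_
        congr 2
        rw [Real.rpow_neg (by positivity), Real.div_rpow hr.le hb.le, Real.rpow_add_one hr.ne']
        field_simp
    _ = _ := lintegral_const_mul' _ _ ENNReal.ofReal_ne_top

/-! ### One-directional estimates -/

omit [FiniteDimensional ℝ E] [BorelSpace E] in
lemma measure_closedAnnulus_ne_zero [Nontrivial E] {a b : ℝ} (ha : 0 ≤ a) (hab : a < b) :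
    μ (closedAnnulus E a b) ≠ 0 := by
  obtain ⟨z, hz⟩ := exists_norm_eq E (show 0 ≤ (a + b) / 2 by linarith)
  have hsub : Metric.ball z ((b - a) / 2) ⊆ closedAnnulus E a b := by
    intro y hy
    rw [mem_ball_iff_norm] at hy
    have := abs_le.1 (abs_norm_sub_norm_le y z)
    constructor <;> linarith
  exact fun h0 => (Metric.measure_ball_pos μ z (by linarith : 0 < (b - a) / 2)).ne'
    (measure_mono_null hsub h0)

omit [BorelSpace E] in
lemma measure_closedAnnulus_ne_top (a b : ℝ) : μ (closedAnnulus E a b) ≠ ∞ := by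
  have := FiniteDimensional.proper_real E
  refine ((measure_mono fun y hy => ?_).trans_lt
    (measure_closedBall_lt_top (μ := μ) (x := (0 : E)) (r := b))).ne
  simpa using hy.2

/-- The energy of the differences in a single direction `ξ` is controlled by the full energy, with a
constant independent of `ξ`. The sets `S` and `S'` localize the estimate: the differences with
`(t, x)` in `S` are bounded by differences with shift `h` and base point `x + c` for pairs
`(h, x + c)` in `S'`. -/
lemma exists_lintegral_direction_le [Nontrivial E] {M : ℕ} (hM : 1 ≤ M) {p θ : ℝ} (hp : 1 ≤ p)
    (hθ : 0 ≤ θ) :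
    ∃ C : ℝ≥0∞, C ≠ ∞ ∧ ∀ (u : E → ℝ), Measurable u → ∀ (S : Set (ℝ × E)) (S' : Set (E × E)),
      MeasurableSet S' → ∀ ξ : E, ‖ξ‖ = 1 →
      (∀ t > 0, ∀ x h c : E, (t, x) ∈ S → t / (4 * M) ≤ ‖h‖ → ‖h‖ ≤ 2 * t → ‖c‖ ≤ M * t →
        (h, x + c) ∈ S') →
      ∫⁻ t in Set.Ioi (0 : ℝ), ENNReal.ofReal (t ^ (-θ - 1)) *
          ∫⁻ x, S.indicator (fun q => ‖(fwdDiff (q.1 • ξ))^[M] u q.2‖ₑ ^ p) (t, x) ∂μ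
        ≤ C * ∫⁻ h, (∫⁻ x, S'.indicator (fun q => ‖(fwdDiff q.1)^[M] u q.2‖ₑ ^ p) (h, x) ∂μ) /
            ENNReal.ofReal (‖h‖ ^ (θ + Module.finrank ℝ E)) ∂μ := by
  have hM0 : (1 : ℝ) ≤ M := by exact_mod_cast hM
  obtain ⟨K, hK, hKle⟩ := exists_enorm_fwdDiff_iter_rpow_le (E := E) hM hp
  obtain ⟨C, hC, hCle⟩ := exists_lintegral_dilate_annulus_le μ (a := 1 / (4 * M)) (b := 2) (θ := θ)
    (by positivity) two_pos hθ
  -- For `w ∈ A` and `1 ≤ k ≤ M`, both `k • w` and `ξ + k • w` lie in `Z`: the outer radius of `A`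
  -- keeps `k • w` half a unit away from `-ξ`, the inner one keeps it away from the origin.
  set A : Set E := closedAnnulus E (1 / (4 * M)) (1 / (2 * M)) with hA
  set Z : Set E := closedAnnulus E (1 / (4 * M)) 2 with hZ
  have hA0 : μ A ≠ 0 := measure_closedAnnulus_ne_zero μ (by positivity) (by
    apply one_div_lt_one_div_of_lt <;> linarith)
  have hAt : μ A ≠ ∞ := measure_closedAnnulus_ne_top μ _ _
  refine ⟨(μ A)⁻¹ * (K * (2 * M)) * C, ENNReal.mul_ne_top (ENNReal.mul_ne_top
    (ENNReal.inv_ne_top.2 hA0) (ENNReal.mul_ne_top hK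
      (ENNReal.mul_ne_top (by simp) (ENNReal.natCast_ne_top _)))) hC, ?_⟩
  intro u hu S S' hS' ξ hξ hSS'
  have := FiniteDimensional.proper_real E
  set G : E × E → ℝ≥0∞ := S'.indicator (fun q => ‖(fwdDiff q.1)^[M] u q.2‖ₑ ^ p) with hG
  have hGm : Measurable G :=
    ((measurable_fwdDiff_iter M hu measurable_fst measurable_snd).enorm.pow_const p).indicator hS'
  set Φ : E → ℝ≥0∞ := fun h => ∫⁻ x, G (h, x) ∂μ with hΦ
  have hΦm : Measurable Φ := hGm.lintegral_prod_right'
  have main : ∀ t > 0,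
      ∫⁻ x, S.indicator (fun q => ‖(fwdDiff (q.1 • ξ))^[M] u q.2‖ₑ ^ p) (t, x) ∂μ
        ≤ (μ A)⁻¹ * (K * (2 * M)) * ∫⁻ z in Z, Φ (t • z) ∂μ := by
    intro t ht
    set I := ∫⁻ x, S.indicator (fun q => ‖(fwdDiff (q.1 • ξ))^[M] u q.2‖ₑ ^ p) (t, x) ∂μ with hI
    have mapsTo₁ : ∀ k ∈ Finset.range M, ∀ w ∈ A, 0 + ((k + 1 : ℕ) : ℝ) • w ∈ Z := by
      intro k hk w hw
      have hk' : ((k + 1 : ℕ) : ℝ) ≤ M := by exact_mod_cast Finset.mem_range.1 hk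
      have hk1 : (1 : ℝ) ≤ ((k + 1 : ℕ) : ℝ) := by exact_mod_cast Nat.le_add_left 1 k
      have hwM : (M : ℝ) * ‖w‖ ≤ 1 / 2 := by
        have := mul_le_mul_of_nonneg_left hw.2 (by linarith : (0 : ℝ) ≤ M)
        calc _ ≤ _ := this
          _ = 1 / 2 := by field_simp
      have e : ‖(0 : E) + ((k + 1 : ℕ) : ℝ) • w‖ = ((k + 1 : ℕ) : ℝ) * ‖w‖ := by
        rw [zero_add, norm_smul, Real.norm_of_nonneg (by positivity)]
      refine ⟨?_, ?_⟩
      · rw [e]; nlinarith [hw.1, norm_nonneg w]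
      · rw [e]; nlinarith [norm_nonneg w]
    have mapsTo₂ : ∀ k ∈ Finset.range M, ∀ w ∈ A, ξ + ((k + 1 : ℕ) : ℝ) • w ∈ Z := by
      intro k hk w hw
      have hk' : ((k + 1 : ℕ) : ℝ) ≤ M := by exact_mod_cast Finset.mem_range.1 hk
      have hwM : (M : ℝ) * ‖w‖ ≤ 1 / 2 := by
        have := mul_le_mul_of_nonneg_left hw.2 (by linarith : (0 : ℝ) ≤ M)
        calc _ ≤ _ := this
          _ = 1 / 2 := by field_simp
      have e : ‖((k + 1 : ℕ) : ℝ) • w‖ ≤ 1 / 2 := by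
        rw [norm_smul, Real.norm_of_nonneg (by positivity)]
        nlinarith [norm_nonneg w]
      have hM4 : 1 / (4 * (M : ℝ)) ≤ 1 / 2 := by
        apply one_div_le_one_div_of_le <;> linarith
      refine ⟨?_, ?_⟩
      · have := norm_sub_le_norm_add ξ (((k + 1 : ℕ) : ℝ) • w)
        linarith
      · have := norm_add_le ξ (((k + 1 : ℕ) : ℝ) • w)
        linarith
    have memS' : ∀ z ∈ Z, ∀ x, (t, x) ∈ S → ∀ c : E, ‖c‖ ≤ M * t → (t • z, x + c) ∈ S' := by
      intro z hz x hx c hc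
      have e : ‖t • z‖ = t * ‖z‖ := by rw [norm_smul, Real.norm_of_nonneg ht.le]
      refine hSS' t ht x _ c hx ?_ ?_ hc
      · rw [e, div_eq_mul_one_div]
        exact mul_le_mul_of_nonneg_left hz.1 ht.le
      · rw [e, mul_comm 2 t]
        exact mul_le_mul_of_nonneg_left hz.2 ht.le
    -- the pointwise bound, integrated in `x`, for each fixed `w` in the annulus
    have slice : ∀ w ∈ A, I ≤ K * ∑ k ∈ Finset.range M,
        (Φ (t • (0 + ((k + 1 : ℕ) : ℝ) • w)) + Φ (t • (ξ + ((k + 1 : ℕ) : ℝ) • w))) := by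
      intro w hw
      have pt : ∀ x, S.indicator (fun q => ‖(fwdDiff (q.1 • ξ))^[M] u q.2‖ₑ ^ p) (t, x)
          ≤ K * ∑ k ∈ Finset.range M,
            (G (t • (0 + ((k + 1 : ℕ) : ℝ) • w), x + (k + 1) • (t • ξ))
              + G (t • (ξ + ((k + 1 : ℕ) : ℝ) • w), x)) := by
        intro x
        by_cases hx : (t, x) ∈ S
        swap
        · simp [hx]
        rw [Set.indicator_of_mem hx]
        refine (hKle (t • ξ) (t • w) u x).trans ?_
        gcongr with k hk
        · have hc : ‖(k + 1) • (t • ξ)‖ ≤ M * t := by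
            rw [← Nat.cast_smul_eq_nsmul ℝ, norm_smul, norm_smul, hξ, mul_one,
              Real.norm_of_nonneg ht.le, Real.norm_of_nonneg (by positivity)]
            gcongr
            exact_mod_cast Finset.mem_range.1 hk
          simp only [hG]
          rw [Set.indicator_of_mem (memS' _ (mapsTo₁ k hk w hw) x hx _ hc), zero_add,
            smul_comm t, Nat.cast_smul_eq_nsmul]
        · have hmem := memS' _ (mapsTo₂ k hk w hw) x hx 0 (by rw [norm_zero]; positivity)
          rw [add_zero] at hmem
          simp only [hG]
          rw [Set.indicator_of_mem hmem, smul_add, smul_comm t, Nat.cast_smul_eq_nsmul]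
      calc I ≤ ∫⁻ x, K * ∑ k ∈ Finset.range M,
            (G (t • (0 + ((k + 1 : ℕ) : ℝ) • w), x + (k + 1) • (t • ξ))
              + G (t • (ξ + ((k + 1 : ℕ) : ℝ) • w), x)) ∂μ := lintegral_mono pt
        _ = K * ∑ k ∈ Finset.range M,
            (Φ (t • (0 + ((k + 1 : ℕ) : ℝ) • w)) + Φ (t • (ξ + ((k + 1 : ℕ) : ℝ) • w))) := by
          rw [lintegral_const_mul' _ _ hK, lintegral_finsetSum _ (by fun_prop)]
          congr 1
          refine Finset.sum_congr rfl fun k _ => ?_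
          rw [lintegral_add_left (by fun_prop)]
          congr 1
          exact lintegral_add_right_eq_self (μ := μ)
            (fun x => G (t • (0 + ((k + 1 : ℕ) : ℝ) • w), x)) _
    have hmul : μ A * I ≤ K * (2 * M) * ∫⁻ z in Z, Φ (t • z) ∂μ := by
      have hΦt : Measurable fun z => Φ (t • z) := hΦm.comp (measurable_const_smul t)
      calc μ A * I = ∫⁻ _ in A, I ∂μ := by rw [setLIntegral_const, mul_comm]
        _ ≤ ∫⁻ w in A, K * ∑ k ∈ Finset.range M,
            (Φ (t • (0 + ((k + 1 : ℕ) : ℝ) • w)) + Φ (t • (ξ + ((k + 1 : ℕ) : ℝ) • w))) ∂μ :=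
          setLIntegral_mono' (measurableSet_closedAnnulus _ _) slice
        _ = K * ∑ k ∈ Finset.range M, (∫⁻ w in A, Φ (t • (0 + ((k + 1 : ℕ) : ℝ) • w)) ∂μ
            + ∫⁻ w in A, Φ (t • (ξ + ((k + 1 : ℕ) : ℝ) • w)) ∂μ) := by
          rw [lintegral_const_mul' _ _ hK, lintegral_finsetSum _ (by fun_prop)]
          congr 1
          exact Finset.sum_congr rfl fun k _ => lintegral_add_left (by fun_prop) _
        _ ≤ K * ∑ k ∈ Finset.range M, (∫⁻ z in Z, Φ (t • z) ∂μ + ∫⁻ z in Z, Φ (t • z) ∂μ) := by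
          refine mul_le_mul' le_rfl (Finset.sum_le_sum fun k hk => add_le_add ?_ ?_)
          · exact setLIntegral_comp_affine_le μ (measurableSet_closedAnnulus _ _)
              (measurableSet_closedAnnulus _ _) hΦt 0
              (by exact_mod_cast Nat.le_add_left 1 k) (mapsTo₁ k hk)
          · exact setLIntegral_comp_affine_le μ (measurableSet_closedAnnulus _ _)
              (measurableSet_closedAnnulus _ _) hΦt ξ
              (by exact_mod_cast Nat.le_add_left 1 k) (mapsTo₂ k hk)
        _ = _ := by
          rw [Finset.sum_const, Finset.card_range, nsmul_eq_mul]
          ring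
    calc I = (μ A)⁻¹ * (μ A * I) := by
          rw [← mul_assoc, ENNReal.inv_mul_cancel hA0 hAt, one_mul]
      _ ≤ (μ A)⁻¹ * (K * (2 * M) * ∫⁻ z in Z, Φ (t • z) ∂μ) := by gcongr
      _ = _ := (mul_assoc _ _ _).symm
  have hcne : (μ A)⁻¹ * (K * (2 * M)) ≠ ∞ := ENNReal.mul_ne_top (ENNReal.inv_ne_top.2 hA0)
    (ENNReal.mul_ne_top hK (ENNReal.mul_ne_top (by simp) (ENNReal.natCast_ne_top _)))
  calc ∫⁻ t in Set.Ioi (0 : ℝ), ENNReal.ofReal (t ^ (-θ - 1)) *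
          ∫⁻ x, S.indicator (fun q => ‖(fwdDiff (q.1 • ξ))^[M] u q.2‖ₑ ^ p) (t, x) ∂μ
      ≤ ∫⁻ t in Set.Ioi (0 : ℝ), ((μ A)⁻¹ * (K * (2 * M))) * (ENNReal.ofReal (t ^ (-θ - 1)) *
          ∫⁻ z in Z, Φ (t • z) ∂μ) := by
        refine setLIntegral_mono' measurableSet_Ioi fun t ht => ?_
        rw [mul_left_comm]
        gcongr
        exact main t ht
    _ = ((μ A)⁻¹ * (K * (2 * M))) * ∫⁻ t in Set.Ioi (0 : ℝ), ENNReal.ofReal (t ^ (-θ - 1)) *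
          ∫⁻ z in Z, Φ (t • z) ∂μ := lintegral_const_mul' _ _ hcne
    _ ≤ _ := by
        rw [mul_assoc _ C]
        gcongr
        exact hCle Φ hΦm

end Annulus

/-! ### Energies as integrals against product measures -/

section Energy
variable {E : Type*} [NormedAddCommGroup E] [NormedSpace ℝ E] [FiniteDimensional ℝ E]
  [MeasurableSpace E] [BorelSpace E] (μ : Measure E) [μ.IsAddHaarMeasure]

/-- The measure `t ^ (-θ - 1) dt dx` on `(0, ∞) × E`, viewed as a measure on `ℝ × E`. -/
noncomputable def rayMeasure (θ : ℝ) : Measure (ℝ × E) :=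
  ((volume.restrict (Set.Ioi (0 : ℝ))).withDensity
    fun t => ENNReal.ofReal (t ^ (-θ - 1))).prod μ

/-- The measure `‖h‖ ^ (-(θ + dim E)) dh dx` on `E × E`. -/
noncomputable def shiftMeasure (θ : ℝ) : Measure (E × E) :=
  (μ.withDensity fun h => (ENNReal.ofReal (‖h‖ ^ (θ + Module.finrank ℝ E)))⁻¹).prod μ

omit [BorelSpace E] in
lemma lintegral_rayMeasure (θ : ℝ) {F : ℝ × E → ℝ≥0∞} (hF : Measurable F) :
    ∫⁻ q, F q ∂rayMeasure μ θ
      = ∫⁻ t in Set.Ioi (0 : ℝ), ENNReal.ofReal (t ^ (-θ - 1)) * ∫⁻ x, F (t, x) ∂μ := by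
  have := FiniteDimensional.proper_real E
  rw [rayMeasure, lintegral_prod _ hF.aemeasurable,
    lintegral_withDensity_eq_lintegral_mul _ (by fun_prop) hF.lintegral_prod_right']
  rfl

lemma lintegral_shiftMeasure (θ : ℝ) {F : E × E → ℝ≥0∞} (hF : Measurable F) :
    ∫⁻ q, F q ∂shiftMeasure μ θ
      = ∫⁻ h, (∫⁻ x, F (h, x) ∂μ) / ENNReal.ofReal (‖h‖ ^ (θ + Module.finrank ℝ E)) ∂μ := by
  have := FiniteDimensional.proper_real E
  rw [shiftMeasure, lintegral_prod _ hF.aemeasurable,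
    lintegral_withDensity_eq_lintegral_mul _ (by fun_prop) hF.lintegral_prod_right']
  refine lintegral_congr fun h => ?_
  rw [Pi.mul_apply, ENNReal.div_eq_inv_mul]

lemma measurable_enorm_fwdDiff_ray (M : ℕ) (p : ℝ) {u : E → ℝ} (hu : Measurable u) (ξ : E) :
    Measurable fun q : ℝ × E => ‖(fwdDiff (q.1 • ξ))^[M] u q.2‖ₑ ^ p := by
  have := FiniteDimensional.proper_real E
  exact (measurable_fwdDiff_iter M hu (by fun_prop) measurable_snd).enorm.pow_const p

lemma measurable_enorm_fwdDiff_shift (M : ℕ) (p : ℝ) {u : E → ℝ} (hu : Measurable u) :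
    Measurable fun q : E × E => ‖(fwdDiff q.1)^[M] u q.2‖ₑ ^ p :=
  (measurable_fwdDiff_iter M hu measurable_fst measurable_snd).enorm.pow_const p

lemma exists_setLIntegral_rayMeasure_le [Nontrivial E] {M : ℕ} (hM : 1 ≤ M) {p θ : ℝ}
    (hp : 1 ≤ p) (hθ : 0 ≤ θ) :
    ∃ C : ℝ≥0∞, C ≠ ∞ ∧ ∀ (u : E → ℝ), Measurable u → ∀ (S : Set (ℝ × E)) (S' : Set (E × E)),
      MeasurableSet S → MeasurableSet S' → ∀ ξ : E, ‖ξ‖ = 1 →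
      (∀ t > 0, ∀ x h c : E, (t, x) ∈ S → t / (4 * M) ≤ ‖h‖ → ‖h‖ ≤ 2 * t → ‖c‖ ≤ M * t →
        (h, x + c) ∈ S') →
      ∫⁻ q in S, ‖(fwdDiff (q.1 • ξ))^[M] u q.2‖ₑ ^ p ∂rayMeasure μ θ
        ≤ C * ∫⁻ q in S', ‖(fwdDiff q.1)^[M] u q.2‖ₑ ^ p ∂shiftMeasure μ θ := by
  obtain ⟨C, hC, hCle⟩ := exists_lintegral_direction_le μ hM hp hθ
  refine ⟨C, hC, fun u hu S S' hS hS' ξ hξ hSS' => ?_⟩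
  rw [← lintegral_indicator hS, ← lintegral_indicator hS',
    lintegral_rayMeasure μ θ ((measurable_enorm_fwdDiff_ray M p hu ξ).indicator hS),
    lintegral_shiftMeasure μ θ ((measurable_enorm_fwdDiff_shift M p hu).indicator hS')]
  exact hCle u hu S S' hS' ξ hξ hSS'

/-! ### Uniform smallness of the tails, and compact sets -/

/-- The compact part `m⁻¹ ≤ t ≤ m`, `‖x‖ ≤ r` of `(0, ∞) × E`. -/
def rayCore (E : Type*) [NormedAddCommGroup E] (m r : ℝ) : Set (ℝ × E) :=
  {q | (m⁻¹ ≤ q.1 ∧ q.1 ≤ m) ∧ ‖q.2‖ ≤ r}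

/-- A set containing all pairs `(h, x)` of a shift and a point that are reached from outside
`rayCore E m ((M + 1) * m)` by shifts of norm between `t / (4 * M)` and `2 * t` and by moving the
base point by at most `M * t`; see `mem_shiftTail`. -/
def shiftTail (E : Type*) [NormedAddCommGroup E] (M : ℕ) (m : ℝ) : Set (E × E) :=
  {q | ‖q.1‖ < 2 / m ∨ m / (4 * M) < ‖q.1‖ ∨ m < ‖q.2‖}

omit [NormedSpace ℝ E] [FiniteDimensional ℝ E] in
lemma measurableSet_rayCore (m r : ℝ) : MeasurableSet (rayCore E m r) :=
  ((measurableSet_le measurable_const measurable_fst).inter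
    (measurableSet_le measurable_fst measurable_const)).inter
    (measurableSet_le measurable_snd.norm measurable_const)

omit [NormedSpace ℝ E] [FiniteDimensional ℝ E] in
lemma measurableSet_shiftTail (M : ℕ) (m : ℝ) : MeasurableSet (shiftTail E M m) :=
  (measurableSet_lt measurable_fst.norm measurable_const).union
    ((measurableSet_lt measurable_const measurable_fst.norm).union
      (measurableSet_lt measurable_const measurable_snd.norm))

omit [NormedSpace ℝ E] [FiniteDimensional ℝ E] [MeasurableSpace E] [BorelSpace E] in
lemma mem_shiftTail {M : ℕ} (hM : 1 ≤ M) {m t : ℝ} {x h c : E}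
    (hx : (t, x) ∈ (rayCore E m ((M + 1) * m))ᶜ) (h₁ : t / (4 * M) ≤ ‖h‖) (h₂ : ‖h‖ ≤ 2 * t)
    (hc : ‖c‖ ≤ M * t) : (h, x + c) ∈ shiftTail E M m := by
  have hM0 : (0 : ℝ) < M := by exact_mod_cast hM
  simp only [shiftTail, Set.mem_ofPred_eq]
  by_cases ht₁ : t < m⁻¹
  · left
    rw [div_eq_mul_inv]
    linarith
  by_cases ht₂ : m < t
  · right; left
    exact (div_lt_div_of_pos_right ht₂ (by positivity)).trans_le h₁
  · right; right
    push Not at ht₁ ht₂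
    have hxr : (M + 1) * m < ‖x‖ := by
      by_contra hcon
      exact hx ⟨⟨ht₁, ht₂⟩, not_lt.1 hcon⟩
    have h3 := norm_sub_le_norm_add x c
    have h4 := mul_le_mul_of_nonneg_left ht₂ hM0.le
    linarith

/-- The tails do not depend on a direction: together with `exists_setLIntegral_rayMeasure_le`
this makes the tails of all directional energies of `u` small at the same time. -/
lemma tendsto_setLIntegral_shiftTail [Nontrivial E] {M : ℕ} (hM : 1 ≤ M) (p θ : ℝ) {u : E → ℝ}
    (hu : Measurable u)
    (hfin : ∫⁻ q, ‖(fwdDiff q.1)^[M] u q.2‖ₑ ^ p ∂shiftMeasure μ θ ≠ ∞) :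
    Tendsto (fun m : ℕ => ∫⁻ q in shiftTail E M m,
      ‖(fwdDiff q.1)^[M] u q.2‖ₑ ^ p ∂shiftMeasure μ θ) atTop (𝓝 0) := by
  have hM0 : (0 : ℝ) < M := by exact_mod_cast hM
  have hmeas := measurable_enorm_fwdDiff_shift M p hu
  have hne : ∀ᵐ q ∂shiftMeasure μ θ, q.1 ≠ 0 := by
    have h0 : ∀ᵐ h ∂(μ.withDensity fun h => (ENNReal.ofReal (‖h‖ ^ (θ + Module.finrank ℝ E)))⁻¹),
        h ≠ 0 := (withDensity_absolutelyContinuous μ _).ae_le (Measure.ae_ne μ 0)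
    exact Measure.quasiMeasurePreserving_fst.ae h0
  simp only [← lintegral_indicator (measurableSet_shiftTail M _)]
  rw [← lintegral_zero (μ := shiftMeasure μ θ)]
  refine tendsto_lintegral_of_dominated_convergence _
    (fun m => hmeas.indicator (measurableSet_shiftTail M _))
    (fun m => Eventually.of_forall fun q => Set.indicator_le_self _ _ q) hfin ?_
  filter_upwards [hne] with q hq
  have hr : 0 < ‖q.1‖ := norm_pos_iff.2 hq
  refine tendsto_const_nhds.congr' ?_
  have hcast := tendsto_natCast_atTop_atTop (R := ℝ)
  filter_upwards [hcast.eventually_ge_atTop (2 / ‖q.1‖), hcast.eventually_ge_atTop (4 * M * ‖q.1‖),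
    hcast.eventually_ge_atTop ‖q.2‖, hcast.eventually_gt_atTop 0] with m h₁ h₂ h₃ h₀
  refine (Set.indicator_of_notMem ?_ _).symm
  simp only [shiftTail, Set.mem_ofPred_eq, not_or, not_lt]
  refine ⟨?_, ?_, h₃⟩
  · rw [div_le_iff₀ h₀]
    rwa [div_le_iff₀' hr] at h₁
  · rw [le_div_iff₀ (by positivity)]
    linarith

/-- On `rayCore` the weight `t ^ (-θ - 1)` is bounded, so that the differences are controlled by
the local `L^p` norm of `u`, with the same constant for all directions. -/
lemma exists_setLIntegral_rayCore_le (M : ℕ) {p θ : ℝ} (hp : 1 ≤ p) (hθ : 0 ≤ θ) {m : ℝ}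
    (hm : 0 < m) (r : ℝ) :
    ∃ C : ℝ≥0∞, C ≠ ∞ ∧ ∀ (u : E → ℝ), Measurable u → ∀ ξ : E, ‖ξ‖ = 1 →
      ∫⁻ q in rayCore E m r, ‖(fwdDiff (q.1 • ξ))^[M] u q.2‖ₑ ^ p ∂rayMeasure μ θ
        ≤ C * ∫⁻ y in Metric.closedBall 0 (r + M * m), ‖u y‖ₑ ^ p ∂μ := by
  obtain ⟨K, hK, hKle⟩ := exists_enorm_fwdDiff_iter_rpow_le_sum (E := E) M hp
  refine ⟨ENNReal.ofReal (m⁻¹ ^ (-θ - 1)) * (K * (M + 1 : ℕ)) * ENNReal.ofReal (m - m⁻¹),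
    ENNReal.mul_ne_top (ENNReal.mul_ne_top ENNReal.ofReal_ne_top
      (ENNReal.mul_ne_top hK (ENNReal.natCast_ne_top _))) ENNReal.ofReal_ne_top,
    fun u hu ξ hξ => ?_⟩
  have hmeas := measurable_enorm_fwdDiff_ray M p hu ξ
  have hup : Measurable fun y => ‖u y‖ₑ ^ p := hu.enorm.pow_const p
  set J := ∫⁻ y in Metric.closedBall 0 (r + M * m), ‖u y‖ₑ ^ p ∂μ with hJ
  have inner : ∀ t ∈ Set.Icc m⁻¹ m,
      ∫⁻ x in Metric.closedBall 0 r, ‖(fwdDiff (t • ξ))^[M] u x‖ₑ ^ p ∂μ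
        ≤ K * (M + 1 : ℕ) * J := by
    intro t ht
    have ht0 : 0 ≤ t := (inv_pos.2 hm).le.trans ht.1
    calc ∫⁻ x in Metric.closedBall 0 r, ‖(fwdDiff (t • ξ))^[M] u x‖ₑ ^ p ∂μ
        ≤ ∫⁻ x in Metric.closedBall 0 r,
            K * ∑ k ∈ Finset.range (M + 1), ‖u (x + k • (t • ξ))‖ₑ ^ p ∂μ :=
          lintegral_mono fun x => hKle _ _ _
      _ = K * ∑ k ∈ Finset.range (M + 1),
            ∫⁻ x in Metric.closedBall 0 r, ‖u (x + k • (t • ξ))‖ₑ ^ p ∂μ := by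
          rw [lintegral_const_mul' _ _ hK, lintegral_finsetSum _ (by fun_prop)]
      _ ≤ K * ∑ _k ∈ Finset.range (M + 1), J := by
          refine mul_le_mul' le_rfl (Finset.sum_le_sum fun k hk => ?_)
          have hkM : (k : ℝ) ≤ M := by
            exact_mod_cast Nat.lt_succ_iff.1 (Finset.mem_range.1 hk)
          have := setLIntegral_comp_affine_le μ (A := Metric.closedBall (0 : E) r)
            (S := Metric.closedBall (0 : E) (r + M * m)) measurableSet_closedBall
            measurableSet_closedBall hup (k • (t • ξ)) le_rfl (fun w hw => ?_)
          · simpa only [one_smul, add_comm] using this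
          · rw [mem_closedBall_zero_iff] at hw ⊢
            have h1 : ‖k • (t • ξ)‖ ≤ M * m := by
              rw [← Nat.cast_smul_eq_nsmul ℝ, norm_smul, norm_smul, hξ, mul_one,
                Real.norm_of_nonneg ht0, Real.norm_of_nonneg (by positivity)]
              exact mul_le_mul hkM ht.2 ht0 (by positivity)
            have := norm_add_le (k • (t • ξ)) w
            rw [one_smul]
            linarith
      _ = K * (M + 1 : ℕ) * J := by
          rw [Finset.sum_const, Finset.card_range, nsmul_eq_mul, mul_assoc]
  rw [← lintegral_indicator (measurableSet_rayCore m r),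
    lintegral_rayMeasure μ θ (hmeas.indicator (measurableSet_rayCore m r))]
  calc ∫⁻ t in Set.Ioi (0 : ℝ), ENNReal.ofReal (t ^ (-θ - 1)) *
        ∫⁻ x, (rayCore E m r).indicator
          (fun q => ‖(fwdDiff (q.1 • ξ))^[M] u q.2‖ₑ ^ p) (t, x) ∂μ
      ≤ ∫⁻ t in Set.Ioi (0 : ℝ), (Set.Icc m⁻¹ m).indicator
          (fun _ => ENNReal.ofReal (m⁻¹ ^ (-θ - 1)) * (K * (M + 1 : ℕ) * J)) t := by
        refine lintegral_mono fun t => ?_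
        by_cases ht : t ∈ Set.Icc m⁻¹ m
        · rw [Set.indicator_of_mem ht]
          refine mul_le_mul' (ENNReal.ofReal_le_ofReal
            (Real.rpow_le_rpow_of_nonpos (inv_pos.2 hm) ht.1 (by linarith))) ?_
          refine le_trans (le_of_eq ?_) (inner t ht)
          rw [← lintegral_indicator measurableSet_closedBall]
          refine lintegral_congr fun x => ?_
          by_cases hx : ‖x‖ ≤ r
          · rw [Set.indicator_of_mem (show (t, x) ∈ rayCore E m r from ⟨ht, hx⟩),
              Set.indicator_of_mem (mem_closedBall_zero_iff.2 hx)]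
          · rw [Set.indicator_of_notMem (fun h : (t, x) ∈ rayCore E m r => hx h.2),
              Set.indicator_of_notMem (fun h => hx (mem_closedBall_zero_iff.1 h))]
        · have h0 : ∀ x, (rayCore E m r).indicator
              (fun q => ‖(fwdDiff (q.1 • ξ))^[M] u q.2‖ₑ ^ p) (t, x) = 0 := fun x =>
            Set.indicator_of_notMem (fun h : (t, x) ∈ rayCore E m r => ht h.1) _
          simp [h0]
    _ ≤ ∫⁻ t, (Set.Icc m⁻¹ m).indicator
          (fun _ => ENNReal.ofReal (m⁻¹ ^ (-θ - 1)) * (K * (M + 1 : ℕ) * J)) t :=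
        setLIntegral_le_lintegral _ _
    _ = _ := by
        rw [lintegral_indicator_const measurableSet_Icc, Real.volume_Icc]
        ring

/-! ### The Brezis–Lieb property, uniformly in the direction -/

/-- The theorem for measurable functions on a finite-dimensional space. On `rayCore` the difference
of `g` takes the small coefficient `ε` in the elementary inequality and that of `f n - g` the large
one; off `rayCore` the roles are exchanged. -/
lemma tendsto_iSup_lintegral_brezisLieb [Nontrivial E] {M : ℕ} (hM : 1 ≤ M) {p θ : ℝ}
    (hp : 1 ≤ p) (hθ : 0 ≤ θ) {f : ℕ → E → ℝ} {g : E → ℝ} (hf : ∀ n, Measurable (f n))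
    (hg : Measurable g) {B : ℝ≥0∞} (hB : B ≠ ∞)
    (hfB : ∀ n, ∫⁻ q, ‖(fwdDiff q.1)^[M] (f n) q.2‖ₑ ^ p ∂shiftMeasure μ θ ≤ B)
    (hgB : ∫⁻ q, ‖(fwdDiff q.1)^[M] g q.2‖ₑ ^ p ∂shiftMeasure μ θ ≠ ∞)
    (hloc : ∀ r : ℝ, Tendsto (fun n => ∫⁻ y in Metric.closedBall 0 r, ‖(f n - g) y‖ₑ ^ p ∂μ)
      atTop (𝓝 0)) :
    Tendsto (fun n => ⨆ ξ : Metric.sphere (0 : E) 1, ∫⁻ q,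
      ENNReal.ofReal |(|(fwdDiff (q.1 • (ξ : E)))^[M] (f n) q.2| ^ p
        - |(fwdDiff (q.1 • (ξ : E)))^[M] (f n - g) q.2| ^ p
        - |(fwdDiff (q.1 • (ξ : E)))^[M] g q.2| ^ p)| ∂rayMeasure μ θ) atTop (𝓝 0) := by
  set G := ∫⁻ q, ‖(fwdDiff q.1)^[M] g q.2‖ₑ ^ p ∂shiftMeasure μ θ with hG
  obtain ⟨C₁, hC₁, hdir⟩ := exists_setLIntegral_rayMeasure_le μ hM hp hθ
  have hdiru : ∀ (u : E → ℝ), Measurable u → ∀ ξ : E, ‖ξ‖ = 1 →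
      ∫⁻ q, ‖(fwdDiff (q.1 • ξ))^[M] u q.2‖ₑ ^ p ∂rayMeasure μ θ
        ≤ C₁ * ∫⁻ q, ‖(fwdDiff q.1)^[M] u q.2‖ₑ ^ p ∂shiftMeasure μ θ := by
    intro u hu ξ hξ
    simpa using hdir u hu Set.univ Set.univ .univ .univ ξ hξ (by simp)
  -- a bound for the directional energies of `f n - g`, uniform in `n` and in the direction
  set A : ℝ≥0∞ := 2 ^ (p - 1) * (C₁ * B + C₁ * G) with hA
  have hAtop : A ≠ ∞ := ENNReal.mul_ne_top
    (ENNReal.rpow_ne_top_of_nonneg (by linarith) (by simp))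
    (ENNReal.add_ne_top.2 ⟨ENNReal.mul_ne_top hC₁ hB, ENNReal.mul_ne_top hC₁ hgB⟩)
  have hdiff : ∀ n, ∀ ξ : E, ‖ξ‖ = 1 →
      ∫⁻ q, ‖(fwdDiff (q.1 • ξ))^[M] (f n - g) q.2‖ₑ ^ p ∂rayMeasure μ θ ≤ A := by
    intro n ξ hξ
    calc _ ≤ ∫⁻ q, 2 ^ (p - 1) * (‖(fwdDiff (q.1 • ξ))^[M] (f n) q.2‖ₑ ^ p
              + ‖(fwdDiff (q.1 • ξ))^[M] g q.2‖ₑ ^ p) ∂rayMeasure μ θ :=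
          lintegral_mono fun q => by
            rw [fwdDiff_iter_sub]; exact enorm_sub_rpow_le hp _ _
      _ = 2 ^ (p - 1) * (∫⁻ q, ‖(fwdDiff (q.1 • ξ))^[M] (f n) q.2‖ₑ ^ p ∂rayMeasure μ θ
              + ∫⁻ q, ‖(fwdDiff (q.1 • ξ))^[M] g q.2‖ₑ ^ p ∂rayMeasure μ θ) := by
          rw [lintegral_const_mul' _ _ (ENNReal.rpow_ne_top_of_nonneg (by linarith) (by simp)),
            lintegral_add_left (measurable_enorm_fwdDiff_ray M p (hf n) ξ)]
      _ ≤ A := by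
          rw [hA]
          refine mul_le_mul' le_rfl (add_le_add ?_ (hdiru g hg ξ hξ))
          exact (hdiru (f n) (hf n) ξ hξ).trans (mul_le_mul' le_rfl (hfB n))
  rw [ENNReal.tendsto_nhds_zero]
  intro η hη
  have hη3 : 0 < η / 3 := ENNReal.div_pos hη.ne' (by simp)
  obtain ⟨ε, hε, hε0⟩ : ∃ ε : ℝ, ENNReal.ofReal ε * (A + C₁ * G) ≤ η / 3 ∧ 0 < ε := by
    have h1 : Tendsto (fun ε : ℝ => ENNReal.ofReal ε * (A + C₁ * G)) (𝓝[>] 0) (𝓝 0) := by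
      have h2 : Tendsto (fun ε : ℝ => ENNReal.ofReal ε) (𝓝[>] 0) (𝓝 0) := by
        simpa using (ENNReal.tendsto_ofReal (tendsto_id (x := 𝓝 (0 : ℝ)))).mono_left
          nhdsWithin_le_nhds
      simpa using ENNReal.Tendsto.mul_const h2 (.inr
        (ENNReal.add_ne_top.2 ⟨hAtop, ENNReal.mul_ne_top hC₁ hgB⟩))
    exact ((ENNReal.tendsto_nhds_zero.1 h1 _ hη3).and self_mem_nhdsWithin).exists
  -- the order of the choices matters: `C` depends on `ε`, then `m` on `C`, and `n` on both
  obtain ⟨C, hC, hBL⟩ := exists_ofReal_abs_abs_add_rpow_sub_le hp hε0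
  obtain ⟨m, hm, hm0⟩ : ∃ m : ℕ, C * (C₁ * ∫⁻ q in shiftTail E M m,
      ‖(fwdDiff q.1)^[M] g q.2‖ₑ ^ p ∂shiftMeasure μ θ) ≤ η / 3 ∧ 0 < m := by
    have h1 := ENNReal.Tendsto.const_mul (ENNReal.Tendsto.const_mul
      (tendsto_setLIntegral_shiftTail μ hM p θ hg hgB) (.inr hC₁)) (.inr hC)
    rw [mul_zero, mul_zero] at h1
    exact ((ENNReal.tendsto_nhds_zero.1 h1 _ hη3).and (eventually_gt_atTop 0)).exists
  have hm0' : (0 : ℝ) < m := by exact_mod_cast hm0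
  obtain ⟨C₂, hC₂, hcore⟩ := exists_setLIntegral_rayCore_le μ M hp hθ hm0' ((M + 1) * m)
  have h1 := ENNReal.Tendsto.const_mul (ENNReal.Tendsto.const_mul
    (hloc ((M + 1) * m + M * m)) (.inr hC₂)) (.inr hC)
  rw [mul_zero, mul_zero] at h1
  filter_upwards [ENNReal.tendsto_nhds_zero.1 h1 _ hη3] with n hn
  refine iSup_le fun ⟨ξ, hξ'⟩ => ?_
  have hξ : ‖ξ‖ = 1 := by simpa using hξ'
  set S : Set (ℝ × E) := rayCore E m ((M + 1) * m) with hS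
  have hSm : MeasurableSet S := measurableSet_rayCore _ _
  set a : ℝ × E → ℝ≥0∞ := fun q => ‖(fwdDiff (q.1 • ξ))^[M] (f n - g) q.2‖ₑ ^ p with ha
  set b : ℝ × E → ℝ≥0∞ := fun q => ‖(fwdDiff (q.1 • ξ))^[M] g q.2‖ₑ ^ p with hb
  have ham : Measurable a := measurable_enorm_fwdDiff_ray M p ((hf n).sub hg) ξ
  have hbm : Measurable b := measurable_enorm_fwdDiff_ray M p hg ξ
  calc ∫⁻ q, ENNReal.ofReal |(|(fwdDiff (q.1 • ξ))^[M] (f n) q.2| ^ p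
        - |(fwdDiff (q.1 • ξ))^[M] (f n - g) q.2| ^ p
        - |(fwdDiff (q.1 • ξ))^[M] g q.2| ^ p)| ∂rayMeasure μ θ
      ≤ ∫⁻ q, (ENNReal.ofReal ε * (a q + b q)
          + C * (Sᶜ.indicator b q + S.indicator a q)) ∂rayMeasure μ θ := by
        refine lintegral_mono fun q => ?_
        have hsum : (fwdDiff (q.1 • ξ))^[M] (f n) q.2
            = (fwdDiff (q.1 • ξ))^[M] (f n - g) q.2 + (fwdDiff (q.1 • ξ))^[M] g q.2 := by
          rw [fwdDiff_iter_sub]; ring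
        by_cases hq : q ∈ S
        · have h2 := hBL ((fwdDiff (q.1 • ξ))^[M] g q.2) ((fwdDiff (q.1 • ξ))^[M] (f n - g) q.2)
          rw [add_comm, ← hsum, sub_right_comm] at h2
          rw [Set.indicator_of_mem hq, Set.indicator_of_notMem (by simpa using hq), zero_add]
          refine h2.trans (add_le_add (mul_le_mul' le_rfl ?_) le_rfl)
          exact le_add_self
        · have h2 := hBL ((fwdDiff (q.1 • ξ))^[M] (f n - g) q.2) ((fwdDiff (q.1 • ξ))^[M] g q.2)
          rw [← hsum] at h2
          rw [Set.indicator_of_notMem hq, Set.indicator_of_mem (by simpa using hq), add_zero]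
          refine h2.trans (add_le_add (mul_le_mul' le_rfl ?_) le_rfl)
          exact le_self_add
    _ = ENNReal.ofReal ε * (∫⁻ q, a q ∂rayMeasure μ θ + ∫⁻ q, b q ∂rayMeasure μ θ)
          + (C * ∫⁻ q in Sᶜ, b q ∂rayMeasure μ θ + C * ∫⁻ q in S, a q ∂rayMeasure μ θ) := by
        rw [lintegral_add_left (by fun_prop), lintegral_const_mul' _ _ ENNReal.ofReal_ne_top,
          lintegral_add_left ham, lintegral_const_mul' _ _ hC,
          lintegral_add_left (hbm.indicator hSm.compl), lintegral_indicator hSm.compl,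
          lintegral_indicator hSm, mul_add C]
    _ ≤ η / 3 + (η / 3 + η / 3) := by
        refine add_le_add ?_ (add_le_add ?_ ?_)
        · exact (mul_le_mul' le_rfl (add_le_add (hdiff n ξ hξ) (hdiru g hg ξ hξ))).trans hε
        · refine (mul_le_mul' le_rfl (hdir g hg Sᶜ (shiftTail E M m) hSm.compl
            (measurableSet_shiftTail _ _) ξ hξ ?_)).trans hm
          intro t _ x h c hx h₁ h₂ hc
          exact mem_shiftTail hM hx h₁ h₂ hc
        · exact (mul_le_mul' le_rfl (hcore _ ((hf n).sub hg) ξ hξ)).trans hn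
    _ = η := by rw [← add_assoc, ENNReal.add_thirds]

end Energy

/-! ### Reduction to measurable representatives -/

lemma fracSeminorm_rpow {N : ℕ} {s p : ℝ} (hp : 1 ≤ p) {u v : EuclideanSpace ℝ (Fin N) → ℝ}
    (hv : Measurable v) (huv : u =ᵐ[volume] v) :
    fracSeminorm s p u ^ p
      = ∫⁻ q, ‖(fwdDiff q.1)^[⌊s⌋₊ + 1] v q.2‖ₑ ^ p ∂shiftMeasure volume (s * p) := by
  have hp0 : 0 < p := by linarith
  rw [fracSeminorm, ← ENNReal.rpow_mul, one_div_mul_cancel hp0.ne', ENNReal.rpow_one,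
    lintegral_shiftMeasure _ _ (measurable_enorm_fwdDiff_shift _ p hv), finrank_euclideanSpace_fin]
  refine lintegral_congr fun h => ?_
  congr 1
  have hD : fracDiff s h u =ᵐ[volume] (fwdDiff h)^[⌊s⌋₊ + 1] v := fwdDiff_iter_congr_ae _ h huv
  rw [eLpNorm_congr_ae hD,
    eLpNorm_eq_lintegral_rpow_enorm_toReal (by simpa using hp0) ENNReal.ofReal_ne_top,
    ENNReal.toReal_ofReal hp0.le, ← ENNReal.rpow_mul, one_div_mul_cancel hp0.ne',
    ENNReal.rpow_one]

theorem lemma3p1 {N : ℕ} {s p : ℝ} (hs : 0 < s) (hs_nonint : ∀ k : ℤ, s ≠ k) (hp : 1 ≤ p)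
    (hsp : s * p < N) {f : ℕ → EuclideanSpace ℝ (Fin N) → ℝ}
    {g : EuclideanSpace ℝ (Fin N) → ℝ} (hfg : WeakConvRingSobolev s p f g) :
    Tendsto
      (fun n => ⨆ ξ : Metric.sphere (0 : EuclideanSpace ℝ (Fin N)) 1,
        ∫⁻ t in Set.Ioi (0 : ℝ), ∫⁻ x : EuclideanSpace ℝ (Fin N),
          ENNReal.ofReal (t ^ (-(s * p) - 1) *
            |(|fracDiff s (t • (ξ : EuclideanSpace ℝ (Fin N))) (f n) x| ^ p
              - |fracDiff s (t • (ξ : EuclideanSpace ℝ (Fin N))) (f n - g) x| ^ p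
              - |fracDiff s (t • (ξ : EuclideanSpace ℝ (Fin N))) g x| ^ p)|))
      atTop (𝓝 0) := by
  have hp0 : 0 < p := by linarith
  have hN : 0 < N := by
    have : (0 : ℝ) < N := (mul_pos hs hp0).trans hsp
    exact_mod_cast this
  have : Nonempty (Fin N) := ⟨⟨0, hN⟩⟩
  obtain ⟨g', hg'm, hgg'⟩ : ∃ g', Measurable g' ∧ g =ᵐ[volume] g' :=
    hfg.mem_lim.2.1.aestronglyMeasurable.aemeasurable
  have hrep : ∀ n, ∃ f', Measurable f' ∧ f n =ᵐ[volume] f' :=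
    fun n => (hfg.mem_seq n).2.1.aestronglyMeasurable.aemeasurable
  choose f' hf'm hff' using hrep
  have hsub : ∀ n, f n - g =ᵐ[volume] f' n - g' := fun n => (hff' n).sub hgg'
  set B := ⨆ n, fracSeminorm s p (f n) with hB
  have key := tendsto_iSup_lintegral_brezisLieb (volume : Measure (EuclideanSpace ℝ (Fin N)))
    (M := ⌊s⌋₊ + 1) (Nat.le_add_left 1 _) (p := p) (θ := s * p) hp (by positivity) hf'm hg'm
    (B := B ^ p) (ENNReal.rpow_ne_top_of_nonneg hp0.le hfg.bounded.ne)
    (fun n => by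
      rw [← fracSeminorm_rpow hp (hf'm n) (hff' n)]
      exact ENNReal.rpow_le_rpow (le_iSup (fun n => fracSeminorm s p (f n)) n) hp0.le)
    (by
      rw [← fracSeminorm_rpow hp hg'm hgg']
      exact ENNReal.rpow_ne_top_of_nonneg hp0.le hfg.mem_lim.2.2.ne)
    (fun r => by
      have h1 :=
        (hfg.tendsto_loc (Metric.closedBall 0 r) (isCompact_closedBall 0 r)).ennrpow_const p
      rw [ENNReal.zero_rpow_of_pos hp0] at h1
      refine h1.congr fun n => ?_
      rw [eLpNorm_congr_ae (ae_restrict_of_ae (hsub n)),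
        eLpNorm_eq_lintegral_rpow_enorm_toReal (by simpa using hp0) ENNReal.ofReal_ne_top,
        ENNReal.toReal_ofReal hp0.le, ← ENNReal.rpow_mul, one_div_mul_cancel hp0.ne',
        ENNReal.rpow_one])
  refine key.congr fun n => iSup_congr fun ξ => ?_
  have hmeas : ∀ u : EuclideanSpace ℝ (Fin N) → ℝ, Measurable u →
      Measurable fun q : ℝ × EuclideanSpace ℝ (Fin N) =>
        (fwdDiff (q.1 • (ξ : EuclideanSpace ℝ (Fin N))))^[⌊s⌋₊ + 1] u q.2 :=
    fun u hu => measurable_fwdDiff_iter _ hu (by fun_prop) measurable_snd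
  have h1 := hmeas _ (hf'm n)
  have h2 := hmeas _ ((hf'm n).sub hg'm)
  have h3 := hmeas _ hg'm
  rw [lintegral_rayMeasure _ _ (by fun_prop)]
  refine setLIntegral_congr_fun measurableSet_Ioi fun t ht => ?_
  have ht0 : 0 < t := ht
  rw [← lintegral_const_mul' _ _ ENNReal.ofReal_ne_top]
  refine lintegral_congr_ae ?_
  filter_upwards [fwdDiff_iter_congr_ae (⌊s⌋₊ + 1) (t • (ξ : EuclideanSpace ℝ (Fin N))) (hff' n),
    fwdDiff_iter_congr_ae (⌊s⌋₊ + 1) (t • (ξ : EuclideanSpace ℝ (Fin N))) (hsub n),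
    fwdDiff_iter_congr_ae (⌊s⌋₊ + 1) (t • (ξ : EuclideanSpace ℝ (Fin N))) hgg'] with x e1 e2 e3
  rw [ENNReal.ofReal_mul (by positivity)]
  simp only [fracDiff]
  rw [e1, e2, e3]
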